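/- Let $q$ be a prime power, let $n\ge 3$, $1\le k\le n$ and $0\le \ell\le k$ be integers, and equip $\mathbb{F}_q^n$ with the dot product. For a subspace (code) $C\le\mathbb{F}_q^n$ let $C^\perp=\{v\in\mathbb{F}_q^n : v\cdot c=0 \text{ for all } c\in C\}$; call $C$ $\ell$-complementary if $\dim(C\cap C^\perp)=\ell$ and self-orthogonal if $C\subseteq C^\perp$. Let $w$ be the Witt index of $(\mathbb{F}_q^n,\cdot)$, i.e. the maximal dimension of a self-orthogonal code in $\mathbb{F}_q^n$. For integers $i,d,m\ge 0$ let \[ A_q^{(i)}(n,d,m)=\sum_{C}\bigl|\{v\in C : v \text{ has exactly } i \text{ nonzero components}\}\bigr| , \] the sum running over all $m$-complementary codes $C\le\mathbb{F}_q^n$ of dimension $d$. For integers $a,b$ let $\binom{a}{b}_q$ be the Gaussian binomial coefficient, that is, $\binom{a}{b}_q=\prod_{t=0}^{b-1}\frac{q^a-q^t}{q^b-q^t}$ if $a,b\ge 0$, and $\binom{a}{b}_q=0$ if $a<0$ or $b<0$. For $i\ge 0$ and $0\le j\le n$ let \[ K_q(n,i,j)=\sum_{r=0}^{i}(-1)^r(q-1)^{i-r}\binom{j}{r}\binom{n-j}{i-r}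 \] be the Krawtchouk coefficients. Then for all $i\ge 0$ \[ A_q^{(i)}(n,k,\ell)=\sum_{s=\ell}^{w}\binom{s}{\ell}_q(-1)^{s-\ell}\,q^{\binom{s-\ell}{2}}\,B(s), \] where, for $\ell\le s\le w$, \[ B(s)=\left(\binom{n-2s}{k-s}_q-\binom{n-2s-1}{k-s-1}_q\right)A_q^{(i)}(n,s,s) +q^{-s}\binom{n-2s-1}{k-s-1}_q\sum_{j=0}^{n}A_q^{(j)}(n,s,s)\,K_q(n,i,j). \] (If $\ell>w$, the sum is empty and equals $0$.) -/

import Mathlib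

open scoped BigOperators

noncomputable section

namespace AggregateWeight

section BilinearSpace

variable {F V : Type*} [Field F] [AddCommGroup V] [Module F V]

/-- The radical `C ∩ C^⊥` of a subspace `C` with respect to the bilinear form `B`. -/
def radical (B : LinearMap.BilinForm F V) (C : Submodule F V) : Submodule F V :=
  C ⊓ B.orthogonal C

/-- `C` is `ℓ`-complementary if `dim (C ∩ C^⊥) = ℓ`. -/
def IsComplementary (B : LinearMap.BilinForm F V) (ℓ : ℕ) (C : Submodule F V) : Prop :=
  Module.finrank F (radical B C) = ℓ

/-- `C` is self-orthogonal (totally isotropic) if `C ⊆ C^⊥`. -/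
def IsSelfOrthogonal (B : LinearMap.BilinForm F V) (C : Submodule F V) : Prop :=
  C ≤ B.orthogonal C

/-- The Witt index: the largest dimension of a self-orthogonal subspace. (In finite dimension the
set of these dimensions contains `0` and is bounded by `dim V`, so the supremum is a maximum.) -/
def wittIndex (B : LinearMap.BilinForm F V) : ℕ :=
  sSup {d : ℕ | ∃ C : Submodule F V, IsSelfOrthogonal B C ∧ Module.finrank F C = d}

/-- `Σ(V, B, k, ℓ)`: the `ℓ`-complementary subspaces of dimension `k`. -/
def complementarySubspaces (B : LinearMap.BilinForm F V) (k ℓ : ℕ) : Set (Submodule F V) :=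
  {C | Module.finrank F C = k ∧ IsComplementary B ℓ C}

end BilinearSpace

section Codes

variable (F : Type*) [Field F] [Fintype F] [DecidableEq F] (n : ℕ)

/-- The dot product `v · w = ∑ i, v i * w i` on `F^n`. -/
def dotForm : LinearMap.BilinForm F (Fin n → F) :=
  dotProductBilin F F

variable {F n} in
/-- `A^{(i)}(C)`: the number of codewords of `C` of Hamming weight `i`. -/
def weightDistribution (C : Submodule F (Fin n → F)) (i : ℕ) : ℕ :=
  Set.ncard {v : Fin n → F | v ∈ C ∧ hammingNorm v = i}

/-- `A_q^{(i)}(n, k, ℓ)`: the number of codewords of weight `i`, summed over all `ℓ`-complementary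
`[n, k]_q`-codes (with respect to the dot product), where `q = |F|`. -/
def aggregateWeight (k ℓ i : ℕ) : ℕ :=
  ∑ C ∈ (Set.toFinite (complementarySubspaces (dotForm F n) k ℓ)).toFinset,
    weightDistribution C i

end Codes

/-- The Gaussian binomial coefficient `[a choose b]_q` for integers `a`, `b`, equal to `0` if
`a < 0` or `b < 0`. For `b > a ≥ 0` the factor with `i = a` vanishes. -/
def gaussianBinomial (q : ℕ) (a b : ℤ) : ℚ :=
  if a < 0 ∨ b < 0 then 0
  else ∏ i ∈ Finset.range b.toNat,
    ((q : ℚ) ^ a.toNat - (q : ℚ) ^ i) / ((q : ℚ) ^ b.toNat - (q : ℚ) ^ i)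

/-- The Krawtchouk coefficient `K_q(n, i, j)`, for `j ≤ n`. -/
def krawtchouk (q n i j : ℕ) : ℚ :=
  ∑ r ∈ Finset.range (i + 1),
    (-1) ^ r * ((q : ℚ) - 1) ^ (i - r) * (j.choose r : ℚ) * ((n - j).choose (i - r) : ℚ)

/-- The term `B(s)`, for the parameters `n`, `k`, `i` and `q = |F|`. -/
def termB (F : Type*) [Field F] [Fintype F] [DecidableEq F] (n k i s : ℕ) : ℚ :=
  (gaussianBinomial (Fintype.card F) ((n : ℤ) - 2 * s) ((k : ℤ) - s)
      - gaussianBinomial (Fintype.card F) ((n : ℤ) - 2 * s - 1) ((k : ℤ) - s - 1))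
    * (aggregateWeight F n s s i : ℚ)
  + ((Fintype.card F : ℚ) ^ s)⁻¹
    * gaussianBinomial (Fintype.card F) ((n : ℤ) - 2 * s - 1) ((k : ℤ) - s - 1)
    * ∑ j ∈ Finset.range (n + 1),
        (aggregateWeight F n s s j : ℚ) * krawtchouk (Fintype.card F) n i j

end AggregateWeight

end

/-!
The formula comes from counting, with multiplicity the number of words of weight `i` in `C`, the
flags `S ≤ C ≤ S^⊥` with `dim S = s` and `dim C = k`; the subspace `S` is then self-orthogonal.

* Grouped by `S`, the total is `B(s)` (`termB_eq_sum`). A word of `S` lies in every `C` of the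
  interval `[S, S^⊥]`, a word `v` of `S^⊥` outside `S` lies exactly in the members of
  `[S + ⟨v⟩, S^⊥]`, and intervals of subspaces are counted by Gaussian binomials
  (`card_submodule_Icc_finrank_eq`). This leaves the weight distribution of `S^⊥`, which the
  MacWilliams identity (`card_mul_weightDistribution_orthogonal`) expresses through that of `S`.
* Grouped by `C`, the condition on `S` is that it be an `s`-dimensional subspace of the radical
  `C ∩ C^⊥`, so each `C` is counted `[dim (C ∩ C^⊥) choose s]_q` times
  (`termB_eq_sum_gaussianBinomial`).

Hence `B(s) = ∑ m, [m choose s]_q A^{(i)}(n, k, m)`. The radical is self-orthogonal, so only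
`m ≤ w` occurs, and Gaussian inversion (`sum_gaussianBinomial_inversion`), a consequence of the
`q`-binomial theorem at `x = -1`, recovers `A^{(i)}(n, k, ℓ)`.

The MacWilliams identity is proved with a nontrivial additive character `ψ` of `F`: the sum of
`ψ (c · v)` over `c` in a code detects the dual code, while its sum over the `v` of weight `i` is a
Krawtchouk coefficient, read off from a generating polynomial that factors over the coordinates.
-/

namespace AggregateWeight

/-! ### Gaussian binomial coefficients -/

theorem gaussianBinomial_natCast (q a b : ℕ) :
    gaussianBinomial q a b =
      ∏ i ∈ Finset.range b, ((q : ℚ) ^ a - (q : ℚ) ^ i) / ((q : ℚ) ^ b - (q : ℚ) ^ i) := by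
  have h : ¬ ((a : ℤ) < 0 ∨ (b : ℤ) < 0) := by omega
  simp [gaussianBinomial, h]

theorem gaussianBinomial_eq_zero_of_neg {q : ℕ} {a b : ℤ} (h : a < 0 ∨ b < 0) :
    gaussianBinomial q a b = 0 := by
  simp [gaussianBinomial, h]

theorem gaussianBinomial_eq_zero_of_lt {q a b : ℕ} (h : a < b) :
    gaussianBinomial q a b = 0 := by
  rw [gaussianBinomial_natCast]
  exact Finset.prod_eq_zero (Finset.mem_range.2 h) (by simp)

/-- The unnormalised `q`-factorial `(q - 1)(q ^ 2 - 1) ⋯ (q ^ n - 1)`. -/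
def qFactorial (q n : ℕ) : ℚ :=
  ∏ t ∈ Finset.range n, ((q : ℚ) ^ (t + 1) - 1)

theorem qFactorial_succ (q n : ℕ) :
    qFactorial q (n + 1) = qFactorial q n * ((q : ℚ) ^ (n + 1) - 1) :=
  Finset.prod_range_succ _ _

@[simp]
theorem qFactorial_zero (q : ℕ) : qFactorial q 0 = 1 := rfl

theorem qFactorial_ne_zero {q : ℕ} (hq : 2 ≤ q) (n : ℕ) : qFactorial q n ≠ 0 := by
  refine Finset.prod_ne_zero_iff.2 fun t _ => ?_
  have h : (1 : ℚ) < q := by exact_mod_cast hq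
  exact (sub_pos.2 (one_lt_pow₀ h (Nat.succ_ne_zero t))).ne'

theorem prod_pow_sub_pow_mul_qFactorial (q b c : ℕ) :
    (∏ i ∈ Finset.range b, ((q : ℚ) ^ (b + c) - (q : ℚ) ^ i)) * qFactorial q c =
      (q : ℚ) ^ b.choose 2 * qFactorial q (b + c) := by
  induction b generalizing c with
  | zero => simp
  | succ b ih =>
    have h := ih (c + 1)
    rw [qFactorial_succ] at h
    rw [Finset.prod_range_succ, Nat.choose_succ_succ' b 1, Nat.choose_one_right,
      show b + 1 + c = b + (c + 1) by ring, pow_add (q : ℚ) b (b.choose 2)]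
    linear_combination (q : ℚ) ^ b * h

/-- For natural numbers `b ≤ a = b + c`, the Gaussian binomial is a quotient of `q`-factorials. -/
theorem gaussianBinomial_add {q : ℕ} (hq : 2 ≤ q) (b c : ℕ) :
    gaussianBinomial q ((b + c : ℕ) : ℤ) b =
      qFactorial q (b + c) / (qFactorial q b * qFactorial q c) := by
  have h1 := prod_pow_sub_pow_mul_qFactorial q b c
  have h2 := prod_pow_sub_pow_mul_qFactorial q b 0
  simp only [qFactorial_zero, add_zero, mul_one] at h2
  have hq0 : (q : ℚ) ^ b.choose 2 ≠ 0 := pow_ne_zero _ (by positivity)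
  have hb := qFactorial_ne_zero hq b
  have hc := qFactorial_ne_zero hq c
  rw [gaussianBinomial_natCast, Finset.prod_div_distrib, h2, eq_div_of_mul_eq hc h1]
  field_simp

theorem gaussianBinomial_self {q : ℕ} (hq : 2 ≤ q) (a : ℕ) : gaussianBinomial q a a = 1 := by
  have h := gaussianBinomial_add hq a 0
  have ha := qFactorial_ne_zero hq a
  simpa [ha] using h

theorem gaussianBinomial_zero_right (q a : ℕ) : gaussianBinomial q a (0 : ℕ) = 1 := by
  rw [gaussianBinomial_natCast, Finset.prod_range_zero]

theorem gaussianBinomial_succ_succ {q : ℕ} (hq : 2 ≤ q) (a b : ℕ) :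
    gaussianBinomial q (a + 1 : ℕ) (b + 1 : ℕ) =
      gaussianBinomial q a b + (q : ℚ) ^ (b + 1) * gaussianBinomial q a (b + 1 : ℕ) := by
  rcases lt_trichotomy a b with h | rfl | h
  · rw [gaussianBinomial_eq_zero_of_lt h, gaussianBinomial_eq_zero_of_lt (by omega),
      gaussianBinomial_eq_zero_of_lt (by omega)]
    simp
  · rw [gaussianBinomial_self hq, gaussianBinomial_self hq,
      gaussianBinomial_eq_zero_of_lt (Nat.lt_succ_self a)]
    simp
  · obtain ⟨c, rfl⟩ : ∃ c, a = b + 1 + c := ⟨a - b - 1, by omega⟩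
    have e1 := gaussianBinomial_add hq (b + 1) (c + 1)
    have e2 := gaussianBinomial_add hq b (c + 1)
    have e3 := gaussianBinomial_add hq (b + 1) c
    rw [show b + (c + 1) = b + 1 + c by ring] at e2
    rw [show b + 1 + c + 1 = b + 1 + (c + 1) by ring, e1, e2, e3,
      show b + 1 + (c + 1) = b + 1 + c + 1 by ring, qFactorial_succ q (b + 1 + c),
      qFactorial_succ q b, qFactorial_succ q c]
    have hb := qFactorial_ne_zero hq b
    have hc := qFactorial_ne_zero hq c
    have hb' := qFactorial_ne_zero hq (b + 1)
    have hc' := qFactorial_ne_zero hq (c + 1)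
    rw [qFactorial_succ] at hb' hc'
    have hb1 := right_ne_zero_of_mul hb'
    have hc1 := right_ne_zero_of_mul hc'
    field_simp
    ring

/-- The `q`-binomial theorem at `x = -1`; the recurrence makes the sum telescope. -/
theorem sum_neg_one_pow_mul_gaussianBinomial {q : ℕ} (hq : 2 ≤ q) (a N : ℕ) (haN : a ≤ N) :
    ∑ j ∈ Finset.range (N + 1),
        (-1 : ℚ) ^ j * (q : ℚ) ^ j.choose 2 * gaussianBinomial q a j = if a = 0 then 1 else 0 := by
  cases a with
  | zero =>
    rw [Finset.sum_range_succ', Finset.sum_eq_zero, gaussianBinomial_zero_right]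
    · simp
    · intro j _
      rw [gaussianBinomial_eq_zero_of_lt (Nat.succ_pos j), mul_zero]
  | succ a =>
    have key : ∀ j : ℕ, (-1 : ℚ) ^ (j + 1) * (q : ℚ) ^ (j + 1).choose 2 *
          gaussianBinomial q (a + 1 : ℕ) (j + 1 : ℕ) =
        (-1 : ℚ) ^ (j + 1) * (q : ℚ) ^ (j + 1).choose 2 * gaussianBinomial q a j -
        (-1 : ℚ) ^ (j + 1 + 1) * (q : ℚ) ^ (j + 1 + 1).choose 2 *
          gaussianBinomial q a (j + 1 : ℕ) := by
      intro j
      rw [gaussianBinomial_succ_succ hq, Nat.choose_succ_succ' (j + 1) 1, Nat.choose_one_right,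
        pow_add (q : ℚ) (j + 1) ((j + 1).choose 2), pow_succ (-1 : ℚ) (j + 1)]
      ring
    rw [Finset.sum_range_succ', Finset.sum_congr rfl fun j _ => key j,
      Finset.sum_range_sub' (fun j : ℕ => (-1 : ℚ) ^ (j + 1) * (q : ℚ) ^ (j + 1).choose 2 *
        gaussianBinomial q a j),
      gaussianBinomial_eq_zero_of_lt (show a < N by omega), gaussianBinomial_zero_right,
      gaussianBinomial_zero_right]
    simp

theorem gaussianBinomial_mul_gaussianBinomial {q : ℕ} (hq : 2 ≤ q) (m ℓ j : ℕ) :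
    gaussianBinomial q (ℓ + m : ℕ) (ℓ + j : ℕ) * gaussianBinomial q (ℓ + j : ℕ) ℓ =
      gaussianBinomial q (ℓ + m : ℕ) ℓ * gaussianBinomial q m j := by
  rcases lt_or_ge m j with h | h
  · rw [gaussianBinomial_eq_zero_of_lt h, gaussianBinomial_eq_zero_of_lt (by omega)]
    simp
  · obtain ⟨c, rfl⟩ := Nat.exists_eq_add_of_le h
    have e1 := gaussianBinomial_add hq (ℓ + j) c
    rw [add_assoc] at e1
    rw [e1, gaussianBinomial_add hq, gaussianBinomial_add hq, gaussianBinomial_add hq]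
    have h1 := qFactorial_ne_zero hq (ℓ + j)
    have h2 := qFactorial_ne_zero hq (j + c)
    field_simp

/-- Gaussian inversion: the matrix of Gaussian binomials is inverted by the signed matrix with
entries `(-1) ^ (s - ℓ) q ^ ((s - ℓ) choose 2) [s choose ℓ]`. -/
theorem sum_gaussianBinomial_inversion {q : ℕ} (hq : 2 ≤ q) (ℓ m w : ℕ) (hmw : m ≤ w) :
    ∑ s ∈ Finset.Icc ℓ w, gaussianBinomial q s ℓ * (-1) ^ (s - ℓ) *
        (q : ℚ) ^ ((s - ℓ).choose 2) * gaussianBinomial q m s = if m = ℓ then 1 else 0 := by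
  rcases lt_or_ge m ℓ with h | h
  · rw [if_neg h.ne]
    refine Finset.sum_eq_zero fun s hs => ?_
    rw [gaussianBinomial_eq_zero_of_lt (h.trans_le (Finset.mem_Icc.1 hs).1), mul_zero]
  · obtain ⟨a, rfl⟩ := Nat.exists_eq_add_of_le h
    obtain ⟨N, rfl⟩ := Nat.exists_eq_add_of_le (h.trans hmw)
    have hterm : ∀ j : ℕ, gaussianBinomial q (ℓ + j : ℕ) ℓ * (-1) ^ (ℓ + j - ℓ) *
        (q : ℚ) ^ ((ℓ + j - ℓ).choose 2) * gaussianBinomial q (ℓ + a : ℕ) (ℓ + j : ℕ) =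
        gaussianBinomial q (ℓ + a : ℕ) ℓ *
          ((-1) ^ j * (q : ℚ) ^ j.choose 2 * gaussianBinomial q a j) := by
      intro j
      rw [Nat.add_sub_cancel_left]
      linear_combination (-1) ^ j * (q : ℚ) ^ j.choose 2 *
        gaussianBinomial_mul_gaussianBinomial hq a ℓ j
    rw [← Finset.Ico_add_one_right_eq_Icc, Finset.sum_Ico_eq_sum_range,
      show ℓ + N + 1 - ℓ = N + 1 by omega, Finset.sum_congr rfl fun j _ => hterm j,
      ← Finset.mul_sum, sum_neg_one_pow_mul_gaussianBinomial hq a N (by omega)]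
    rcases Nat.eq_zero_or_pos a with rfl | ha
    · simp [gaussianBinomial_self hq]
    · simp [ha.ne']

/-! ### Counting subspaces -/

section Counting

variable {F : Type*} [Field F]

/-- The linearly independent `k`-tuples spanning a given `k`-dimensional subspace `C` are the
linearly independent `k`-tuples in `C`. -/
def linearIndependentSpanEquiv {V : Type*} [AddCommGroup V] [Module F V]
    [FiniteDimensional F V] {k : ℕ} (C : Submodule F V) (hC : Module.finrank F C = k) :
    {s : {s : Fin k → V // LinearIndependent F s} // Submodule.span F (Set.range s.1) = C} ≃
      {t : Fin k → C // LinearIndependent F t} where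
  toFun s := ⟨fun i => ⟨s.1.1 i, s.2.le (Submodule.subset_span (Set.mem_range_self i))⟩,
    LinearIndependent.of_comp C.subtype s.1.2⟩
  invFun t := ⟨⟨fun i => t.1 i, t.2.map' C.subtype C.ker_subtype⟩, by
    refine Submodule.eq_of_le_of_finrank_eq (Submodule.span_le.2 ?_) ?_
    · rintro _ ⟨i, rfl⟩
      exact (t.1 i).2
    · rw [hC]
      exact (finrank_span_eq_card (t.2.map' C.subtype C.ker_subtype)).trans (Fintype.card_fin k)⟩
  left_inv _ := rfl
  right_inv _ := rfl

variable [Fintype F] {V : Type*} [AddCommGroup V] [Module F V] [Finite V]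

/-- Counting linearly independent `k`-tuples by their span: each `k`-dimensional subspace is spanned
by as many of them as a `k`-dimensional space has ordered bases. -/
theorem card_submodule_finrank_eq (k : ℕ) :
    (Nat.card {C : Submodule F V // Module.finrank F C = k} : ℚ) =
      gaussianBinomial (Fintype.card F) (Module.finrank F V) k := by
  have hq : 2 ≤ Fintype.card F := Fintype.one_lt_card
  have hcast : ∀ a, k ≤ a → ((∏ i : Fin k, (Fintype.card F ^ a - Fintype.card F ^ i.val) : ℕ) : ℚ) =
      ∏ i ∈ Finset.range k, ((Fintype.card F : ℚ) ^ a - (Fintype.card F : ℚ) ^ i) := by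
    intro a ha
    rw [Finset.prod_range, Nat.cast_prod]
    refine Finset.prod_congr rfl fun i _ => ?_
    rw [Nat.cast_sub (Nat.pow_le_pow_right (by omega) (i.2.le.trans ha))]
    push_cast
    rfl
  rcases lt_or_ge (Module.finrank F V) k with h | h
  · rw [gaussianBinomial_eq_zero_of_lt h, Nat.cast_eq_zero]
    have : IsEmpty {C : Submodule F V // Module.finrank F C = k} :=
      ⟨fun C => by have := Submodule.finrank_le C.1; have := C.2; omega⟩
    exact Nat.card_of_isEmpty
  · let f : {s : Fin k → V // LinearIndependent F s} →
        {C : Submodule F V // Module.finrank F C = k} :=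
      fun s => ⟨Submodule.span F (Set.range s.1), by
        rw [finrank_span_eq_card s.2, Fintype.card_fin]⟩
    have hfib : ∀ C, Nat.card {s // f s = C} =
        ∏ i : Fin k, (Fintype.card F ^ k - Fintype.card F ^ i.val) := by
      intro C
      have e : {s // f s = C} ≃ {t : Fin k → C.1 // LinearIndependent F t} :=
        (Equiv.subtypeEquivRight fun s => by simp [f, Subtype.ext_iff]).trans
          (linearIndependentSpanEquiv C.1 C.2)
      rw [Nat.card_congr e, card_linearIndependent C.2.ge, C.2]
    have h1 := Nat.card_congr (Equiv.sigmaFiberEquiv f)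
    have := Fintype.ofFinite {C : Submodule F V // Module.finrank F C = k}
    rw [Nat.card_sigma, Finset.sum_congr rfl fun C _ => hfib C, Finset.sum_const,
      card_linearIndependent h, smul_eq_mul, Finset.card_univ, ← Nat.card_eq_fintype_card] at h1
    have h2 := congrArg (Nat.cast : ℕ → ℚ) h1
    rw [Nat.cast_mul, hcast _ le_rfl, hcast _ h] at h2
    rw [gaussianBinomial_natCast, Finset.prod_div_distrib]
    refine eq_div_of_mul_eq ?_ h2
    have h3 := prod_pow_sub_pow_mul_qFactorial (Fintype.card F) k 0
    simp only [qFactorial_zero, add_zero, mul_one] at h3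
    rw [h3]
    exact mul_ne_zero (pow_ne_zero _ (by positivity)) (qFactorial_ne_zero hq k)

omit [Fintype F] in
theorem finrank_comap_mkQ (U : Submodule F V) (D : Submodule F (V ⧸ U)) :
    Module.finrank F (D.comap U.mkQ) = Module.finrank F D + Module.finrank F U := by
  have h1 := LinearMap.finrank_range_add_finrank_ker (U.mkQ.domRestrict (D.comap U.mkQ))
  have hU : U ≤ D.comap U.mkQ := Submodule.le_comap_mkQ U D
  rw [LinearMap.range_domRestrict, Submodule.map_comap_eq_of_surjective U.mkQ_surjective,
    LinearMap.ker_domRestrict, Submodule.ker_mkQ,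
    (Submodule.comapSubtypeEquivOfLe hU).finrank_eq] at h1
  exact h1.symm

/-- The interval `[U, W]` of subspaces is the lattice of subspaces of `W / U`; hence its members of
dimension `k` are counted by a Gaussian binomial coefficient. -/
theorem card_submodule_Icc_finrank_eq {U W : Submodule F V} (hUW : U ≤ W) (k : ℕ) :
    (Nat.card {C : Submodule F V // (U ≤ C ∧ C ≤ W) ∧ Module.finrank F C = k} : ℚ) =
      gaussianBinomial (Fintype.card F) ((Module.finrank F W : ℤ) - Module.finrank F U)
        ((k : ℤ) - Module.finrank F U) := by
  rcases lt_or_ge k (Module.finrank F U) with h | h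
  · rw [gaussianBinomial_eq_zero_of_neg (Or.inr (by omega)), Nat.cast_eq_zero]
    have : IsEmpty {C : Submodule F V // (U ≤ C ∧ C ≤ W) ∧ Module.finrank F C = k} :=
      ⟨fun C => by have := Submodule.finrank_mono C.2.1.1; have := C.2.2; omega⟩
    exact Nat.card_of_isEmpty
  · set U' : Submodule F W := U.comap W.subtype with hU'
    have hrU : Module.finrank F U' = Module.finrank F U :=
      (Submodule.comapSubtypeEquivOfLe hUW).finrank_eq
    let f : Submodule F (W ⧸ U') → Submodule F V := fun D => (D.comap U'.mkQ).map W.subtype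
    have hf : ∀ D, Module.finrank F (f D) = Module.finrank F D + Module.finrank F U := by
      intro D
      rw [Submodule.finrank_map_subtype_eq, finrank_comap_mkQ, hrU]
    have hinj : Function.Injective f :=
      (Submodule.map_injective_of_injective W.subtype_injective).comp
        (Submodule.comap_injective_of_surjective U'.mkQ_surjective)
    have hUf : ∀ D, U ≤ f D := by
      intro D
      have h1 : U'.map W.subtype ≤ f D := Submodule.map_mono (Submodule.le_comap_mkQ U' D)
      rwa [hU', Submodule.map_comap_subtype, inf_eq_right.2 hUW] at h1
    let g : {D : Submodule F (W ⧸ U') // Module.finrank F D = k - Module.finrank F U} →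
        {C : Submodule F V // (U ≤ C ∧ C ≤ W) ∧ Module.finrank F C = k} :=
      fun D => ⟨f D, ⟨hUf D, Submodule.map_subtype_le W _⟩, by rw [hf, D.2]; omega⟩
    have hg : Function.Bijective g := by
      constructor
      · intro D D' h
        exact Subtype.ext (hinj (congrArg Subtype.val h))
      · rintro ⟨C, ⟨hUC, hCW⟩, hC⟩
        have hfC : f ((C.comap W.subtype).map U'.mkQ) = C := by
          change ((((C.comap W.subtype).map U'.mkQ).comap U'.mkQ).map W.subtype) = C
          rw [Submodule.comap_map_mkQ, sup_eq_right.2 (Submodule.comap_mono hUC),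
            Submodule.map_comap_subtype, inf_eq_right.2 hCW]
        refine ⟨⟨(C.comap W.subtype).map U'.mkQ, ?_⟩, Subtype.ext hfC⟩
        have := hf ((C.comap W.subtype).map U'.mkQ)
        rw [hfC] at this
        omega
    have : Finite (W ⧸ U') := Finite.of_surjective _ U'.mkQ_surjective
    have hrank := Submodule.finrank_quotient_add_finrank U'
    rw [← Nat.card_congr (Equiv.ofBijective g hg), card_submodule_finrank_eq]
    congr 1 <;> omega

end Counting

/-! ### The MacWilliams identity -/

section MacWilliams
open Polynomial

theorem mem_orthogonal_dotForm {F : Type*} [Field F] {n : ℕ} {C : Submodule F (Fin n → F)} {v : Fin n → F} :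
    v ∈ (dotForm F n).orthogonal C ↔ ∀ c ∈ C, c ⬝ᵥ v = 0 :=
  Iff.rfl

variable {F : Type*} [Field F] [Fintype F] [DecidableEq F] {n : ℕ}

theorem weightDistribution_eq_card (C : Submodule F (Fin n → F)) (i : ℕ)
    [DecidablePred (· ∈ C)] :
    weightDistribution C i = (Finset.univ.filter fun v => v ∈ C ∧ hammingNorm v = i).card := by
  rw [weightDistribution, ← Set.ncard_coe_finset]
  simp

/-- The Krawtchouk coefficient `K_q(n, i, j)` is the coefficient of `X ^ i` in
`(1 - X) ^ j (1 + (q - 1) X) ^ (n - j)`. -/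
theorem coeff_eq_krawtchouk (q n i j : ℕ) :
    (((1 - X) ^ j * (1 + C ((q : ℂ) - 1) * X) ^ (n - j) : ℂ[X])).coeff i =
      (krawtchouk q n i j : ℂ) := by
  have h1 : ∀ r, ((1 - X : ℂ[X]) ^ j).coeff r = (-1) ^ r * (j.choose r : ℂ) := by
    intro r
    have : (1 - X : ℂ[X]) ^ j = ((1 + X) ^ j).comp (C (-1) * X) := by
      simp [sub_eq_add_neg]
    rw [this, comp_C_mul_X_coeff, coeff_one_add_X_pow, mul_comm]
  have h2 : ∀ m r, ((1 + C ((q : ℂ) - 1) * X) ^ m : ℂ[X]).coeff r =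
      ((q : ℂ) - 1) ^ r * (m.choose r : ℂ) := by
    intro m r
    have : (1 + C ((q : ℂ) - 1) * X) ^ m = ((1 + X : ℂ[X]) ^ m).comp (C ((q : ℂ) - 1) * X) := by
      simp
    rw [this, comp_C_mul_X_coeff, coeff_one_add_X_pow, mul_comm]
  rw [coeff_mul, Finset.Nat.sum_antidiagonal_eq_sum_range_succ_mk, krawtchouk]
  push_cast
  refine Finset.sum_congr rfl fun r _ => ?_
  rw [h1, h2]
  ring

/-- The contribution of one coordinate to the generating polynomial of a character by Hamming
weight. -/
theorem sum_addChar_mul_pow {ψ : AddChar F ℂ} (hψ : ψ.IsPrimitive) (a : F) :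
    ∑ x : F, C (ψ (a * x)) * (if x = 0 then 1 else X : ℂ[X]) =
      if a = 0 then 1 + C ((Fintype.card F : ℂ) - 1) * X else 1 - X := by
  have h0 : ∑ x : F, ψ (a * x) = if a = 0 then (Fintype.card F : ℂ) else 0 := by
    simpa [mul_comm] using AddChar.sum_mulShift a hψ
  have h1 : ∀ x : F, C (ψ (a * x)) * (if x = 0 then 1 else X : ℂ[X]) =
      C (ψ (a * x)) * X + if x = 0 then (1 - X) else 0 := by
    intro x
    split_ifs with h
    · simp [h]
    · simp
  rw [Finset.sum_congr rfl fun x _ => h1 x, Finset.sum_add_distrib, ← Finset.sum_mul, ← map_sum, h0]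
  split_ifs
  · simp
    ring
  · simp

/-- The generating polynomial by Hamming weight of the character `v ↦ ψ (c · v)` factors over the
coordinates. -/
theorem sum_addChar_dotProduct_mul_X_pow {ψ : AddChar F ℂ} (hψ : ψ.IsPrimitive)
    (c : Fin n → F) :
    ∑ v : Fin n → F, C (ψ (c ⬝ᵥ v)) * (X : ℂ[X]) ^ hammingNorm v =
      (1 - X) ^ hammingNorm c * (1 + C ((Fintype.card F : ℂ) - 1) * X) ^ (n - hammingNorm c) := by
  have h1 : ∀ v : Fin n → F, C (ψ (c ⬝ᵥ v)) * (X : ℂ[X]) ^ hammingNorm v =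
      ∏ t, C (ψ (c t * v t)) * (if v t = 0 then 1 else X : ℂ[X]) := by
    intro v
    have hsum : ψ (c ⬝ᵥ v) = ∏ t, ψ (c t * v t) :=
      map_prod ψ.toMonoidHom (fun t => Multiplicative.ofAdd (c t * v t)) Finset.univ
    rw [Finset.prod_mul_distrib, ← map_prod, hsum,
      Finset.prod_ite]
    simp [hammingNorm]
  rw [Finset.sum_congr rfl fun v _ => h1 v,
    ← Fintype.prod_sum fun t x => C (ψ (c t * x)) * (if x = 0 then 1 else X : ℂ[X]),
    Finset.prod_congr rfl fun t _ => sum_addChar_mul_pow hψ (c t), Finset.prod_ite]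
  have h2 := Finset.card_filter_add_card_filter_not (s := (Finset.univ : Finset (Fin n)))
    (fun t => c t = 0)
  rw [Finset.card_univ, Fintype.card_fin] at h2
  have h3 : (Finset.univ.filter fun t => c t = 0).card = n - hammingNorm c := by
    change _ = n - (Finset.univ.filter fun t => ¬ c t = 0).card
    omega
  rw [Finset.prod_const, Finset.prod_const, h3, mul_comm]
  rfl

theorem sum_addChar_eq_krawtchouk {ψ : AddChar F ℂ} (hψ : ψ.IsPrimitive) (c : Fin n → F) (i : ℕ) :
    ∑ v : Fin n → F, (if hammingNorm v = i then ψ (c ⬝ᵥ v) else 0) =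
      (krawtchouk (Fintype.card F) n i (hammingNorm c) : ℂ) := by
  rw [← coeff_eq_krawtchouk, ← sum_addChar_dotProduct_mul_X_pow hψ, finsetSum_coeff]
  refine Finset.sum_congr rfl fun v _ => ?_
  rw [coeff_C_mul, coeff_X_pow]
  simp [eq_comm]

open scoped Classical in
/-- Orthogonality of characters on a code: the sum of `ψ (c · v)` over `c ∈ D` detects whether `v`
lies in the dual code. -/
theorem sum_addChar_submodule {ψ : AddChar F ℂ} (hψ : ψ.IsPrimitive)
    (D : Submodule F (Fin n → F)) (v : Fin n → F) :
    ∑ c : D, ψ ((c : Fin n → F) ⬝ᵥ v) =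
      if v ∈ (dotForm F n).orthogonal D then (Fintype.card D : ℂ) else 0 := by
  let χ : AddChar D ℂ :=
    ψ.compAddMonoidHom (((dotForm F n).flip v).comp D.subtype).toAddMonoidHom
  have hχ : ∀ c : D, χ c = ψ ((c : Fin n → F) ⬝ᵥ v) := fun c => rfl
  have key : χ = 0 ↔ v ∈ (dotForm F n).orthogonal D := by
    rw [mem_orthogonal_dotForm]
    constructor
    · intro h c hc
      by_contra hne
      refine hψ hne (DFunLike.ext _ _ fun x => ?_)
      have := DFunLike.congr_fun h (⟨x • c, D.smul_mem x hc⟩ : D)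
      rw [hχ] at this
      simpa [AddChar.mulShift_apply, mul_comm] using this
    · intro h
      ext c
      rw [hχ, h c c.2]
      simp
  have := AddChar.sum_eq_ite χ
  simp only [hχ, key] at this
  exact this

/-- The MacWilliams identity for the dual code `D^⊥`. -/
theorem card_mul_weightDistribution_orthogonal (D : Submodule F (Fin n → F)) (i : ℕ) :
    (Fintype.card F : ℚ) ^ Module.finrank F D * weightDistribution ((dotForm F n).orthogonal D) i =
      ∑ j ∈ Finset.range (n + 1),
        (weightDistribution D j : ℚ) * krawtchouk (Fintype.card F) n i j := by
  classical
  obtain ⟨ψ₀, hψ₀⟩ := AddChar.exists_apply_ne_zero.2 (one_ne_zero : (1 : F) ≠ 0)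
  have hψ : ψ₀.IsPrimitive := AddChar.IsPrimitive.of_ne_one fun h => hψ₀ (by simp [h])
  have hcard : (Fintype.card D : ℂ) = (Fintype.card F : ℂ) ^ Module.finrank F D := by
    rw [Module.card_eq_pow_finrank (K := F) (V := D)]
    push_cast
    rfl
  -- Both sides evaluate the sum of `ψ (c · v)` over `c ∈ D` and `v` of weight `i`.
  have hdouble : ∑ c : D, ∑ v : Fin n → F,
        (if hammingNorm v = i then ψ₀ ((c : Fin n → F) ⬝ᵥ v) else 0) =
      (Fintype.card F : ℂ) ^ Module.finrank F D *
        weightDistribution ((dotForm F n).orthogonal D) i := by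
    rw [Finset.sum_comm]
    have : ∀ v : Fin n → F,
        ∑ c : D, (if hammingNorm v = i then ψ₀ ((c : Fin n → F) ⬝ᵥ v) else 0) =
        if v ∈ (dotForm F n).orthogonal D ∧ hammingNorm v = i then
          (Fintype.card D : ℂ) else 0 := by
      intro v
      by_cases hv : hammingNorm v = i
      · simp [hv, sum_addChar_submodule hψ]
      · simp [hv]
    rw [Finset.sum_congr rfl fun v _ => this v, ← Finset.sum_filter, Finset.sum_const,
      weightDistribution_eq_card, nsmul_eq_mul, hcard, mul_comm]
  have hK : ∑ c : D, (krawtchouk (Fintype.card F) n i (hammingNorm (c : Fin n → F)) : ℂ) =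
      ∑ j ∈ Finset.range (n + 1),
        (weightDistribution D j : ℂ) * krawtchouk (Fintype.card F) n i j := by
    rw [← Finset.sum_subtype (Finset.univ.filter (· ∈ D)) (by simp)
      (fun c : Fin n → F => (krawtchouk (Fintype.card F) n i (hammingNorm c) : ℂ)),
      ← Finset.sum_fiberwise_of_maps_to (t := Finset.range (n + 1)) (g := hammingNorm)]
    · refine Finset.sum_congr rfl fun j _ => ?_
      rw [weightDistribution_eq_card, Finset.filter_filter, ← nsmul_eq_mul, ← Finset.sum_const]
      refine Finset.sum_congr rfl fun v hv => ?_
      rw [(Finset.mem_filter.1 hv).2.2]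
    · intro v _
      have := hammingNorm_le_card_fintype (x := v)
      rw [Fintype.card_fin] at this
      exact Finset.mem_range.2 (by omega)
  have hfinal := hdouble.symm.trans
    ((Finset.sum_congr rfl fun (c : D) _ => sum_addChar_eq_krawtchouk hψ (c : Fin n → F) i).trans hK)
  exact_mod_cast hfinal

end MacWilliams

/-! ### Codes and their radicals -/

section DotProduct

variable {F : Type*} [Field F] {n : ℕ}

theorem finrank_orthogonal_dotForm (C : Submodule F (Fin n → F)) :
    Module.finrank F C + Module.finrank F ((dotForm F n).orthogonal C) = n := by
  have hker : (dotForm F n).ker = ⊥ := by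
    refine LinearMap.ker_eq_bot'.2 fun v hv => dotProduct_eq_zero v fun w => ?_
    exact LinearMap.congr_fun hv w
  have h := LinearMap.BilinForm.finrank_add_finrank_orthogonal' (B := dotForm F n) C
  rwa [hker, inf_bot_eq, finrank_bot, add_zero, Module.finrank_fin_fun] at h

theorem le_orthogonal_dotForm_comm {C D : Submodule F (Fin n → F)} :
    C ≤ (dotForm F n).orthogonal D ↔ D ≤ (dotForm F n).orthogonal C := by
  constructor <;> intro h x hx y hy <;> exact (dotProduct_comm y x).trans (h hy x hx)

/-- The subspaces `S` with `S ≤ C ≤ S^⊥` are exactly the subspaces of the radical of `C`. -/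
theorem le_radical_dotForm_iff {S C : Submodule F (Fin n → F)} :
    S ≤ radical (dotForm F n) C ↔ S ≤ C ∧ C ≤ (dotForm F n).orthogonal S := by
  rw [radical, le_inf_iff, le_orthogonal_dotForm_comm]

theorem isSelfOrthogonal_radical {V : Type*} [AddCommGroup V] [Module F V]
    (B : LinearMap.BilinForm F V) (C : Submodule F V) : IsSelfOrthogonal B (radical B C) :=
  inf_le_right.trans (LinearMap.BilinForm.orthogonal_le inf_le_left)

theorem finrank_le_wittIndex {V : Type*} [AddCommGroup V] [Module F V] [FiniteDimensional F V]
    {B : LinearMap.BilinForm F V} {S : Submodule F V} (hS : IsSelfOrthogonal B S) :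
    Module.finrank F S ≤ wittIndex B := by
  refine le_csSup ⟨Module.finrank F V, ?_⟩ ⟨S, hS, rfl⟩
  rintro _ ⟨C, -, rfl⟩
  exact Submodule.finrank_le C

/-- The `s`-complementary subspaces of dimension `s` are the self-orthogonal ones. -/
theorem mem_complementarySubspaces_self {V : Type*} [AddCommGroup V] [Module F V]
    [FiniteDimensional F V] {B : LinearMap.BilinForm F V} {s : ℕ} {S : Submodule F V} :
    S ∈ complementarySubspaces B s s ↔ Module.finrank F S = s ∧ IsSelfOrthogonal B S := by
  refine and_congr_right fun hs => ?_
  rw [IsComplementary, IsSelfOrthogonal, radical, ← inf_eq_left]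
  constructor
  · intro h
    exact Submodule.eq_of_le_of_finrank_eq inf_le_left (h.trans hs.symm)
  · intro h
    rw [h, hs]

end DotProduct

/-! ### Double counting flags `S ≤ C ≤ S^⊥` -/

section Flags

variable {F : Type*} [Field F] [Fintype F] [DecidableEq F] {n : ℕ}

open scoped Classical in
theorem weightDistribution_eq_sum (C : Submodule F (Fin n → F)) (i : ℕ) :
    (weightDistribution C i : ℚ) =
      ∑ v : Fin n → F with hammingNorm v = i, if v ∈ C then 1 else 0 := by
  rw [weightDistribution_eq_card, Finset.sum_boole, Finset.filter_filter]
  simp only [and_comm]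

omit [DecidableEq F] in
open scoped Classical in
/-- A word `v` of `S` lies in every `C` between `S` and `S^⊥`; a word of `S^⊥` outside `S` lies in
those that contain `S + ⟨v⟩`; no other word lies in any. -/
theorem card_submodule_Icc_orthogonal_mem {S : Submodule F (Fin n → F)} {s : ℕ}
    (hs : Module.finrank F S = s) (hS : IsSelfOrthogonal (dotForm F n) S) (k : ℕ)
    (v : Fin n → F) :
    (Nat.card {C : Submodule F (Fin n → F) // ((S ≤ C ∧ C ≤ (dotForm F n).orthogonal S) ∧
        Module.finrank F C = k) ∧ v ∈ C} : ℚ) =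
      if v ∈ S then gaussianBinomial (Fintype.card F) ((n : ℤ) - 2 * s) ((k : ℤ) - s)
      else if v ∈ (dotForm F n).orthogonal S then
        gaussianBinomial (Fintype.card F) ((n : ℤ) - 2 * s - 1) ((k : ℤ) - s - 1)
      else 0 := by
  have hn := finrank_orthogonal_dotForm S
  split_ifs with h1 h2
  · rw [Nat.card_congr (Equiv.subtypeEquivRight fun C =>
        and_iff_left_of_imp fun hC : (S ≤ C ∧ C ≤ (dotForm F n).orthogonal S) ∧
          Module.finrank F C = k => hC.1.1 h1), card_submodule_Icc_finrank_eq hS, hs]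
    congr 1
    omega
  · have hr := Submodule.finrank_sup_span_singleton (K := F) h1
    have hle : S ⊔ Submodule.span F {v} ≤ (dotForm F n).orthogonal S :=
      sup_le hS ((Submodule.span_singleton_le_iff_mem _ _).2 h2)
    rw [Nat.card_congr (Equiv.subtypeEquivRight fun C => show _ ↔
        ((S ⊔ Submodule.span F {v} ≤ C ∧ C ≤ (dotForm F n).orthogonal S) ∧
          Module.finrank F C = k) by
        rw [sup_le_iff, Submodule.span_singleton_le_iff_mem]; tauto),
      card_submodule_Icc_finrank_eq hle, hr, hs]
    congr 1 <;> omega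
  · rw [Nat.cast_eq_zero]
    have : IsEmpty {C : Submodule F (Fin n → F) // ((S ≤ C ∧ C ≤ (dotForm F n).orthogonal S) ∧
        Module.finrank F C = k) ∧ v ∈ C} := ⟨fun C => h2 (C.2.1.1.2 C.2.2)⟩
    exact Nat.card_of_isEmpty

open scoped Classical in
theorem sum_weightDistribution_Icc_orthogonal {S : Submodule F (Fin n → F)} {s : ℕ}
    (hs : Module.finrank F S = s) (hS : IsSelfOrthogonal (dotForm F n) S) (k i : ℕ) :
    ∑ C : Submodule F (Fin n → F) with
        (S ≤ C ∧ C ≤ (dotForm F n).orthogonal S) ∧ Module.finrank F C = k,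
        (weightDistribution C i : ℚ) =
      (gaussianBinomial (Fintype.card F) ((n : ℤ) - 2 * s) ((k : ℤ) - s)
        - gaussianBinomial (Fintype.card F) ((n : ℤ) - 2 * s - 1) ((k : ℤ) - s - 1))
        * weightDistribution S i
      + gaussianBinomial (Fintype.card F) ((n : ℤ) - 2 * s - 1) ((k : ℤ) - s - 1)
        * weightDistribution ((dotForm F n).orthogonal S) i := by
  simp only [weightDistribution_eq_sum]
  rw [Finset.sum_comm, Finset.mul_sum, Finset.mul_sum, ← Finset.sum_add_distrib]
  refine Finset.sum_congr rfl fun v _ => ?_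
  rw [Finset.sum_boole, Finset.filter_filter, ← Fintype.card_subtype, ← Nat.card_eq_fintype_card,
    card_submodule_Icc_orthogonal_mem hs hS]
  by_cases h1 : v ∈ S
  · have h2 : v ∈ (dotForm F n).orthogonal S := hS h1
    simp [h1, h2]
  · simp [h1]

open scoped Classical in
theorem aggregateWeight_eq_sum (k ℓ i : ℕ) :
    (aggregateWeight F n k ℓ i : ℚ) =
      ∑ C : Submodule F (Fin n → F) with C ∈ complementarySubspaces (dotForm F n) k ℓ,
        (weightDistribution C i : ℚ) := by
  rw [aggregateWeight, Nat.cast_sum]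
  refine Finset.sum_congr ?_ fun _ _ => rfl
  ext C
  simp

open scoped Classical in
/-- `B(s)` is the total weight count over all flags `S ≤ C ≤ S^⊥` with `dim S = s` and
`dim C = k`, grouped by `S`. -/
theorem termB_eq_sum (k i s : ℕ) :
    termB F n k i s =
      ∑ S : Submodule F (Fin n → F) with S ∈ complementarySubspaces (dotForm F n) s s,
        ∑ C : Submodule F (Fin n → F) with
          (S ≤ C ∧ C ≤ (dotForm F n).orthogonal S) ∧ Module.finrank F C = k,
          (weightDistribution C i : ℚ) := by
  have hinner : ∀ S ∈ Finset.univ.filter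
      fun S : Submodule F (Fin n → F) => S ∈ complementarySubspaces (dotForm F n) s s,
      ∑ C : Submodule F (Fin n → F) with
          (S ≤ C ∧ C ≤ (dotForm F n).orthogonal S) ∧ Module.finrank F C = k,
          (weightDistribution C i : ℚ) =
        (gaussianBinomial (Fintype.card F) ((n : ℤ) - 2 * s) ((k : ℤ) - s)
          - gaussianBinomial (Fintype.card F) ((n : ℤ) - 2 * s - 1) ((k : ℤ) - s - 1))
          * weightDistribution S i
        + ((Fintype.card F : ℚ) ^ s)⁻¹
          * gaussianBinomial (Fintype.card F) ((n : ℤ) - 2 * s - 1) ((k : ℤ) - s - 1)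
          * ∑ j ∈ Finset.range (n + 1),
              (weightDistribution S j : ℚ) * krawtchouk (Fintype.card F) n i j := by
    intro S hS
    obtain ⟨hs, hS⟩ := mem_complementarySubspaces_self.1 (Finset.mem_filter.1 hS).2
    have hq : (Fintype.card F : ℚ) ^ s ≠ 0 := pow_ne_zero _ (by simp)
    rw [sum_weightDistribution_Icc_orthogonal hs hS, ← card_mul_weightDistribution_orthogonal, hs]
    field_simp
  rw [Finset.sum_congr rfl hinner, Finset.sum_add_distrib, ← Finset.mul_sum, ← Finset.mul_sum,
    Finset.sum_comm, termB, aggregateWeight_eq_sum]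
  simp only [aggregateWeight_eq_sum, Finset.sum_mul]

open scoped Classical in
/-- The same total, grouped by `C`: the flags over `C` are the `s`-dimensional subspaces of the
radical of `C`. -/
theorem termB_eq_sum_gaussianBinomial (k i s : ℕ) :
    termB F n k i s =
      ∑ C : Submodule F (Fin n → F) with
          Module.finrank F (C : Submodule F (Fin n → F)) = k,
        gaussianBinomial (Fintype.card F) (Module.finrank F (radical (dotForm F n) C)) s
          * (weightDistribution C i : ℚ) := by
  rw [termB_eq_sum, Finset.sum_comm' (t' := Finset.univ.filter
    fun C : Submodule F (Fin n → F) => Module.finrank F C = k) (s' := fun C =>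
      Finset.univ.filter fun S : Submodule F (Fin n → F) =>
        (⊥ ≤ S ∧ S ≤ radical (dotForm F n) C) ∧ Module.finrank F S = s)]
  · refine Finset.sum_congr rfl fun C _ => ?_
    have h := card_submodule_Icc_finrank_eq (F := F)
      (bot_le : ⊥ ≤ radical (dotForm F n) C) s
    rw [finrank_bot, Nat.cast_zero, sub_zero, sub_zero, Nat.card_eq_fintype_card,
      Fintype.card_subtype] at h
    rw [Finset.sum_const, nsmul_eq_mul, h]
  · intro S C
    simp only [Finset.mem_filter, Finset.mem_univ, true_and, mem_complementarySubspaces_self,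
      le_radical_dotForm_iff, bot_le]
    constructor
    · rintro ⟨⟨hs, -⟩, hSC, hk⟩
      exact ⟨⟨hSC, hs⟩, hk⟩
    · rintro ⟨⟨hSC, hs⟩, hk⟩
      exact ⟨⟨hs, hSC.1.trans hSC.2⟩, hSC, hk⟩

end Flags

end AggregateWeight

theorem mainTheorem2 {F : Type*} [Field F] [Fintype F] [DecidableEq F] (n k ℓ : ℕ)
    (hn : 3 ≤ n) (hk : 1 ≤ k) (hkn : k ≤ n) (hℓ : ℓ ≤ k) (i : ℕ) :
    (AggregateWeight.aggregateWeight F n k ℓ i : ℚ) =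
      ∑ s ∈ Finset.Icc ℓ (AggregateWeight.wittIndex (AggregateWeight.dotForm F n)),
        AggregateWeight.gaussianBinomial (Fintype.card F) s ℓ
          * (-1) ^ (s - ℓ) * (Fintype.card F : ℚ) ^ ((s - ℓ).choose 2)
          * AggregateWeight.termB F n k i s := by
  classical
  open AggregateWeight in
  simp only [termB_eq_sum_gaussianBinomial, Finset.mul_sum]
  rw [Finset.sum_comm, aggregateWeight_eq_sum]
  -- With the two sums exchanged, inversion selects the codes whose radical has dimension `ℓ`.
  have hinv : ∀ C : Submodule F (Fin n → F),
      ∑ s ∈ Finset.Icc ℓ (wittIndex (dotForm F n)),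
        gaussianBinomial (Fintype.card F) s ℓ
          * (-1) ^ (s - ℓ) * (Fintype.card F : ℚ) ^ ((s - ℓ).choose 2)
          * (gaussianBinomial (Fintype.card F) (Module.finrank F (radical (dotForm F n) C)) s
            * (weightDistribution C i : ℚ)) =
      if IsComplementary (dotForm F n) ℓ C then (weightDistribution C i : ℚ) else 0 := by
    intro C
    have h := sum_gaussianBinomial_inversion (q := Fintype.card F) Fintype.one_lt_card ℓ _ _
      (finrank_le_wittIndex (isSelfOrthogonal_radical (dotForm F n) C))
    simp only [← mul_assoc]
    rw [← Finset.sum_mul, h, ite_mul, one_mul, zero_mul]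
    exact if_congr Iff.rfl rfl rfl
  rw [Finset.sum_congr rfl fun C _ => hinv C, ← Finset.sum_filter, Finset.filter_filter]
  exact Finset.sum_congr (Finset.filter_congr fun _ _ => Iff.rfl) fun _ _ => rfl
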